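/- **Setting.** Let $\Omega$ be a (standard Borel) state space with prior $D\in\Delta(\Omega)$. An experiment is a Markov kernel $\sigma$ from $\Omega$ to a signal space; $\sigma|\mu$ denotes the distribution over posterior beliefs that it induces at the belief $\mu$. Let $\sigma^F$ be the fully revealing experiment and $\sigma^N$ the null experiment. The agent has a private type $\theta\in\Theta=[a,b]$, $0\le a<b$, drawn from a distribution $F$ with density $f$, positive on $(a,b)$, and her valuation of a belief is separable and convex: $V(\mu,\theta)=v(\mu)\,\theta$, where $v$ is a convex function on a convex set of beliefs that contains $D$ and is closed (almost surely) under updating by experiments, $v$ is integrable under $\sigma|\mu$ for every belief $\mu$ in this set and every experiment $\sigma$, and $v$ is monotone in the Blackwell order. After receiving a signal from the data broker, and so holding a belief $\mu$, the agent may conduct any experiment $\hat\sigma$ of a set $\hat\Sigma\ni\sigma^N$ at cost $C^A(\hat\sigma,\mu)\ge 0$, with $C^A(\sigma^N,\mu)=0$. Put $$V(\mu,\hat\Sigma,\theta)=\sup_{\hat\sigma\in\hat\Sigma}\Big(\mathbb E_{\hat\mu\sim\hat\sigma|\mu}[V(\hat\mu,\theta)]-C^A(\hat\sigma,\mu)\Big).$$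 A mechanism $(\pi,p)$ assigns to each type $\theta$ a distribution $\pi(\theta)$ over experiments (the realized experiment $\sigma\sim\pi(\theta)$ is announced) and a payment $p(\theta)\in\mathbb R$, such that the expectations below exist; write $\mathbb E_{\mu\sim\pi(\theta)|D}=\mathbb E_{\sigma\sim\pi(\theta)}\mathbb E_{\mu\sim\sigma|D}$. It is incentive compatible if $\mathbb E_{\mu\sim\pi(\theta)|D}[V(\mu,\hat\Sigma,\theta)]-p(\theta)\ge\mathbb E_{\mu\sim\pi(\theta')|D}[V(\mu,\hat\Sigma,\theta)]-p(\theta')$ for all $\theta,\theta'\in\Theta$, and individually rational if $\mathbb E_{\mu\sim\pi(\theta)|D}[V(\mu,\hat\Sigma,\theta)]-p(\theta)\ge V(D,\hat\Sigma,\theta)$ for all $\theta\in\Theta$. A mechanism is optimal if it maximizes the revenue $\mathbb E_{\theta\sim F}[p(\theta)]$ among all incentive compatible and individually rational mechanisms. Posting a price $p$ for full information is the mechanism in which every type $\theta$ with $\mathbb E_{\mu\sim\sigma^F|D}[V(\mu,\hat\Sigma,\theta)]-p\ge V(D,\hat\Sigma,\theta)$ receives $\sigma^F$ and pays $p$, and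 every other type receives $\sigma^N$ and pays $0$. Assume that $F$ is regular, that is, the virtual value $\phi(\theta)=\theta-\frac{1-F(\theta)}{f(\theta)}$ is non-decreasing on $(a,b)$, and let $\theta^*=\inf\{\theta:\phi(\theta)\ge 0\}$ be the monopoly type. **Proposition 3.** Suppose that the null experiment is optimal for the monopoly type at the prior: $$\sigma^N\in\arg\max_{\hat\sigma\in\hat\Sigma}\ \mathbb E_{\hat\mu\sim\hat\sigma|D}[V(\hat\mu,\theta^*)]-C^A(\hat\sigma,D).$$ Then, for some price $p\ge 0$, posting the price $p$ for full information is an optimal mechanism. Moreover, for every type $\theta\in\Theta$ with $\theta<\theta^*$, the null experiment also maximizes $\mathbb E_{\hat\mu\sim\hat\sigma|D}[V(\hat\mu,\theta)]-C^A(\hat\sigma,D)$ over $\hat\sigma\in\hat\Sigma$, and it is strictly better than every $\hat\sigma\in\hat\Sigma$ of positive cost $C^A(\hat\sigma,D)>0$. -/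

import Mathlib

open MeasureTheory ProbabilityTheory Set

noncomputable section

namespace InfoSale

universe u

/-- An experiment on the state space `Ω`: a signal space together with a Markov kernel sending each
state to a distribution over signals. -/
structure Experiment (Ω : Type u) [MeasurableSpace Ω] where
  Signal : Type u
  [measSignal : MeasurableSpace Signal]
  kernel : Kernel Ω Signal
  [markov : IsMarkovKernel kernel]

attribute [instance] Experiment.measSignal Experiment.markov

namespace Experiment

variable {Ω : Type u} [MeasurableSpace Ω]

/-- The null experiment: a single signal, which is always sent. -/
def null (Ω : Type u) [MeasurableSpace Ω] : Experiment Ω where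
  Signal := PUnit.{u + 1}
  kernel := Kernel.const Ω (Measure.dirac PUnit.unit)

/-- The fully revealing experiment: the signal is the state itself. -/
def full (Ω : Type u) [MeasurableSpace Ω] : Experiment Ω where
  Signal := Ω
  kernel := Kernel.id

/-- `τ` is Blackwell less informative than `σ`: its signal is obtained from the signal of `σ` by
a state-independent stochastic transformation. -/
def IsGarblingOf (τ σ : Experiment Ω) : Prop :=
  ∃ η : Kernel σ.Signal τ.Signal, IsMarkovKernel η ∧ τ.kernel = η ∘ₖ σ.kernel

variable [StandardBorelSpace Ω] [Nonempty Ω]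

/-- The posterior belief about the state after conducting `σ` at the belief `μ` and observing
the signal `s` (a version of the conditional law of the state given the signal). -/
def post (σ : Experiment Ω) (μ : ProbabilityMeasure Ω) (s : σ.Signal) : ProbabilityMeasure Ω :=
  ⟨(posterior σ.kernel (μ : Measure Ω)) s, inferInstance⟩

/-- The distribution `σ|μ` over posterior beliefs induced by the experiment `σ` at the belief `μ`:
draw the state from `μ`, then the signal from `σ`, then form the posterior. -/
def law (σ : Experiment Ω) (μ : ProbabilityMeasure Ω) : Measure (ProbabilityMeasure Ω) :=
  (σ.kernel ∘ₘ (μ : Measure Ω)).map (σ.post μ)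

end Experiment

/-- A distribution over experiments, as the law of a random experiment `exp x`, `x ∼ prob`, drawn
independently of the state and announced publicly. -/
structure RandomExperiment (Ω : Type u) [MeasurableSpace Ω] where
  Index : Type u
  [measIndex : MeasurableSpace Index]
  prob : Measure Index
  [isProb : IsProbabilityMeasure prob]
  exp : Index → Experiment Ω

attribute [instance] RandomExperiment.measIndex RandomExperiment.isProb

namespace RandomExperiment

variable {Ω : Type u} [MeasurableSpace Ω]

/-- The degenerate distribution at a single experiment. -/
def det (σ : Experiment Ω) : RandomExperiment Ω where
  Index := PUnit.{u + 1}
  prob := Measure.dirac PUnit.unit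
  exp := fun _ => σ

variable [StandardBorelSpace Ω] [Nonempty Ω]

/-- `E_{μ ∼ π|D} g(μ) = E_{σ ∼ π} E_{μ ∼ σ|D} g(μ)`. -/
def expect (π : RandomExperiment Ω) (D : ProbabilityMeasure Ω) (g : ProbabilityMeasure Ω → ℝ) : ℝ :=
  ∫ x, (∫ μ, g μ ∂((π.exp x).law D)) ∂π.prob

/-- The expectation `E_{μ ∼ π|D} g(μ)` exists (and is finite). -/
def HasExpect (π : RandomExperiment Ω) (D : ProbabilityMeasure Ω)
    (g : ProbabilityMeasure Ω → ℝ) : Prop :=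
  (∀ᵐ x ∂π.prob, Integrable g ((π.exp x).law D)) ∧
    Integrable (fun x => ∫ μ, g μ ∂((π.exp x).law D)) π.prob

end RandomExperiment

/-- The primitives of the model with a convex separable valuation `V(μ,θ) = v(μ) θ`.

`beliefs` is the set of beliefs at which the value `v` is defined: all of `Δ(Ω)` if, for instance,
`v` is bounded, but only the beliefs of finite variance if `v(μ) = -Var(μ)`. -/
structure Environment (Ω : Type u) [MeasurableSpace Ω] [StandardBorelSpace Ω] [Nonempty Ω] where
  /-- the prior `D` over the states -/
  prior : ProbabilityMeasure Ω
  beliefs : Set (ProbabilityMeasure Ω)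
  prior_mem : prior ∈ beliefs
  /-- updating on the result of an experiment does not leave the set of beliefs -/
  post_mem : ∀ μ ∈ beliefs, ∀ σ : Experiment Ω, ∀ᵐ ν ∂(σ.law μ), ν ∈ beliefs
  /-- the value `v(μ)` of a belief -/
  v : ProbabilityMeasure Ω → ℝ
  /-- the expected value of every experiment exists -/
  v_integrable : ∀ μ ∈ beliefs, ∀ σ : Experiment Ω, Integrable v (σ.law μ)
  /-- the set of beliefs and the function `v` on it are convex -/
  v_convex : ∀ μ ∈ beliefs, ∀ ν ∈ beliefs, ∀ t : ℝ, 0 ≤ t → t ≤ 1 →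
    ∀ ρ : ProbabilityMeasure Ω,
      (ρ : Measure Ω) =
        ENNReal.ofReal t • (μ : Measure Ω) + ENNReal.ofReal (1 - t) • (ν : Measure Ω) →
      ρ ∈ beliefs ∧ v ρ ≤ t * v μ + (1 - t) * v ν
  /-- the value is monotone in the Blackwell order -/
  v_blackwell : ∀ μ ∈ beliefs, ∀ σ τ : Experiment Ω, τ.IsGarblingOf σ →
    ∫ ν, v ν ∂(τ.law μ) ≤ ∫ ν, v ν ∂(σ.law μ)
  /-- the set of experiments that the agent can conduct herself -/
  acq : Set (Experiment Ω)
  null_mem : Experiment.null Ω ∈ acq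
  /-- the cost `C(σ, μ)` for the agent of conducting `σ` at the belief `μ` -/
  cost : Experiment Ω → ProbabilityMeasure Ω → ℝ
  cost_nonneg : ∀ σ ∈ acq, ∀ μ ∈ beliefs, 0 ≤ cost σ μ
  cost_null : ∀ μ ∈ beliefs, cost (Experiment.null Ω) μ = 0

/-- A direct mechanism: each reported type is assigned a distribution over experiments and
a payment. Types range over an interval `[a, b]`; values outside it are irrelevant. -/
structure Mechanism (Ω : Type u) [MeasurableSpace Ω] where
  alloc : ℝ → RandomExperiment Ω
  price : ℝ → ℝ

namespace Environment

variable {Ω : Type u} [MeasurableSpace Ω] [StandardBorelSpace Ω] [Nonempty Ω]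
variable (E : Environment Ω)

/-- The valuation `V(μ, θ)` of type `θ` at the belief `μ`. -/
def V (μ : ProbabilityMeasure Ω) (θ : ℝ) : ℝ := E.v μ * θ

/-- The expected payoff of type `θ` with belief `μ` from conducting `σ` herself, net of its cost. -/
def net (σ : Experiment Ω) (μ : ProbabilityMeasure Ω) (θ : ℝ) : ℝ :=
  (∫ ν, E.V ν θ ∂(σ.law μ)) - E.cost σ μ

/-- The maximal payoff of type `θ` with belief `μ` when she can conduct
any of the experiments available to her. -/
def Vacq (μ : ProbabilityMeasure Ω) (θ : ℝ) : ℝ := ⨆ σ : E.acq, E.net σ.1 μ θ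

/-- The interim value for type `θ` of receiving a signal from `π`, before payments. -/
def value (π : RandomExperiment Ω) (θ : ℝ) : ℝ := π.expect E.prior (fun μ => E.Vacq μ θ)

/-- All expectations that occur in the constraints and in the revenue exist. -/
def WellDefined (a b : ℝ) (F : Measure ℝ) (M : Mechanism Ω) : Prop :=
  (∀ θ ∈ Icc a b, ∀ θ' ∈ Icc a b, (M.alloc θ').HasExpect E.prior (fun μ => E.Vacq μ θ)) ∧
    Integrable M.price F

def IncentiveCompatible (a b : ℝ) (M : Mechanism Ω) : Prop :=
  ∀ θ ∈ Icc a b, ∀ θ' ∈ Icc a b,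
    E.value (M.alloc θ') θ - M.price θ' ≤ E.value (M.alloc θ) θ - M.price θ

def IndividuallyRational (a b : ℝ) (M : Mechanism Ω) : Prop :=
  ∀ θ ∈ Icc a b, E.Vacq E.prior θ ≤ E.value (M.alloc θ) θ - M.price θ

def Feasible (a b : ℝ) (F : Measure ℝ) (M : Mechanism Ω) : Prop :=
  E.WellDefined a b F M ∧ E.IncentiveCompatible a b M ∧ E.IndividuallyRational a b M

/-- Expected revenue when types are distributed according to `F`. -/
def revenue (F : Measure ℝ) (M : Mechanism Ω) : ℝ := ∫ θ, M.price θ ∂F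

/-- `M` is feasible and maximizes revenue among all feasible mechanisms. -/
def IsOptimal (a b : ℝ) (F : Measure ℝ) (M : Mechanism Ω) : Prop :=
  E.Feasible a b F M ∧ ∀ M' : Mechanism Ω, E.Feasible a b F M' → revenue F M' ≤ revenue F M

/-- Type `θ` is willing to pay `p` for full information. -/
def Buys (p θ : ℝ) : Prop :=
  E.Vacq E.prior θ ≤ E.value (RandomExperiment.det (Experiment.full Ω)) θ - p

open Classical in
/-- Posting the price `p` for full information: the types that are willing to pay `p` receive
full information and pay `p`; the others receive no information and pay nothing. -/
def postedPrice (p : ℝ) : Mechanism Ω where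
  alloc θ := RandomExperiment.det (if E.Buys p θ then Experiment.full Ω else Experiment.null Ω)
  price θ := if E.Buys p θ then p else 0

end Environment

/-- The virtual value `φ(θ) = θ - (1 - F(θ)) / f(θ)`. -/
def virtualValue (F : Measure ℝ) (f : ℝ → ℝ) (θ : ℝ) : ℝ := θ - (1 - cdf F θ) / f θ

/-- The monopoly type `θ*`, the infimum of the types with nonnegative virtual value. The end points
of `[a, b]`, at which the density may vanish or be modified, do not affect the infimum. -/
def monopolyType (a b : ℝ) (F : Measure ℝ) (f : ℝ → ℝ) : ℝ :=
  sInf {θ | θ ∈ Ioo a b ∧ 0 ≤ virtualValue F f θ}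

end InfoSale

end

namespace InfoSale

universe u

/-! Let `Δ = vfull D - v D` be the gain in `v` from full information at the prior. For any feasible
mechanism, measure the payoff of type `θ` against `v D * θ`; call this rent `W`. Conducting an
experiment has expected `v`-value between `v μ` and `vfull μ` by Blackwell monotonicity, so the
value of any allocation has slope in `θ` between `v D` and `vfull D`, and incentive compatibility
forces the slopes of `W` into `[0, Δ]`.

Because the agent can acquire information at a cost, the usual envelope identity becomes an
inequality. Nonnegative costs make `Vacq μ θ / θ` nondecreasing, and with incentive compatibility
this gives `p θ ≤ θ * W' θ - W θ` (`price_add_rent_mul_le`, `deriv_bounds`). Integrating by parts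
(`virtual_surplus`) and using `W a ≥ 0`, revenue is at most the integral of `W' φ f`. Regularity
makes this largest when `W'` is `0` below the monopoly type `c` and `Δ` above it, with value that of
collecting `c * Δ` from all types above `c` (`integral_price_le`).

Posting the price `c * Δ` attains the bound. If the null experiment is optimal at `c`, it is optimal
below `c`, so there the outside option is `v D * θ`. Full information is worth `vfull D * θ`, as
nothing is left to learn, so for `Δ > 0` the buyers are exactly the types from `c` on
(`postedPrice_price_eq`). -/

lemma integral_measure_comp {α β : Type*} [MeasurableSpace α] [MeasurableSpace β]
    {κ : Kernel α β} {m : Measure α} {g : β → ℝ} (h : Integrable g (κ ∘ₘ m)) :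
    Integrable (fun x => ∫ y, g y ∂(κ x)) m ∧
      ∫ x, ∫ y, g y ∂(κ x) ∂m = ∫ y, g y ∂(κ ∘ₘ m) := by
  rw [Measure.comp_eq_comp_const_apply] at h ⊢
  exact ⟨h.integral_comp, (Kernel.integral_comp h).symm⟩

/-! ### Belief spaces and the laws of particular experiments -/

section Laws

variable {Ω : Type u} [MeasurableSpace Ω]

/-- The belief that the state is `ω`. -/
noncomputable def certain (ω : Ω) : ProbabilityMeasure Ω := ⟨Measure.dirac ω, inferInstance⟩

lemma measurable_certain : Measurable (certain : Ω → ProbabilityMeasure Ω) :=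
  Measure.measurable_dirac.subtype_mk

lemma certain_injective [MeasurableSpace.SeparatesPoints Ω] :
    Function.Injective (certain : Ω → ProbabilityMeasure Ω) := fun ω ω' h =>
  MeasurableSpace.SeparatesPoints.separates (α := Ω) ω ω' fun s hs hω => by
    have h1 : (certain ω : Measure Ω) s = (certain ω' : Measure Ω) s := by rw [h]
    simp only [certain, ProbabilityMeasure.coe_mk, Measure.dirac_apply' _ hs,
      indicator_of_mem hω] at h1
    by_contra hn
    simp [indicator_of_notMem hn] at h1

/-- A probability measure is determined by its values on a countable generating algebra, so the
conditions `q < μ s` with `q` rational separate beliefs. This makes singletons measurable, which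
lets arbitrary functions be integrated against Dirac laws, and it makes the set of certain beliefs
measurable. -/
instance [MeasurableSpace.CountablyGenerated Ω] :
    MeasurableSpace.CountablySeparated (ProbabilityMeasure Ω) where
  countably_separated := by
    have hC := countable_generateSetAlgebra
      (MeasurableSpace.countable_countableGeneratingSet (α := Ω))
    set C := generateSetAlgebra (MeasurableSpace.countableGeneratingSet Ω)
    have hgen : ‹MeasurableSpace Ω› = MeasurableSpace.generateFrom C := by
      rw [generateFrom_generateSetAlgebra_eq,
        MeasurableSpace.generateFrom_countableGeneratingSet]
    have hmeas : ∀ s ∈ C, MeasurableSet s := fun s hs => by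
      rw [hgen]; exact MeasurableSpace.measurableSet_generateFrom hs
    have hpi : IsPiSystem C := fun s hs t ht _ =>
      isSetAlgebra_generateSetAlgebra.inter_mem hs ht
    let S : Set Ω × ℚ → Set (ProbabilityMeasure Ω) :=
      fun p => {μ | (p.2 : ℝ) < (μ : Measure Ω).real p.1}
    refine ⟨S '' (C ×ˢ univ), (hC.prod countable_univ).image _, ?_, fun μ _ ν _ h => ?_⟩
    · rintro _ ⟨p, hp, rfl⟩
      exact measurableSet_lt measurable_const
        ((Measure.measurable_coe (hmeas _ hp.1)).comp measurable_subtype_coe).ennreal_toReal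
    · refine Subtype.ext ?_
      have : IsProbabilityMeasure μ.1 := μ.2
      have : IsProbabilityMeasure ν.1 := ν.2
      refine ext_of_generate_finite C hgen hpi (fun s hs => ?_) (by simp)
      refine (measureReal_eq_measureReal_iff).1 ?_
      refine eq_of_forall_rat_lt_iff_lt fun q => ?_
      exact h _ (mem_image_of_mem S (mk_mem_prod hs (mem_univ q)))

instance [MeasurableSpace.CountablyGenerated Ω] :
    MeasurableSingletonClass (ProbabilityMeasure Ω) where
  measurableSet_singleton D := by
    obtain ⟨g, hg, hinj⟩ :=
      MeasurableSpace.measurable_injection_nat_bool_of_countablySeparated (ProbabilityMeasure Ω)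
    rw [← hinj.preimage_image {D}, image_singleton]
    exact hg (measurableSet_singleton _)

lemma Experiment.isGarblingOf_full (σ : Experiment Ω) : σ.IsGarblingOf (Experiment.full Ω) :=
  ⟨σ.kernel, σ.markov, (Kernel.comp_id σ.kernel).symm⟩

lemma Experiment.null_isGarblingOf (σ : Experiment Ω) :
    (Experiment.null Ω).IsGarblingOf σ :=
  ⟨Kernel.const σ.Signal (Measure.dirac (PUnit.unit : PUnit.{u + 1})),
    inferInstanceAs (IsMarkovKernel
      (Kernel.const σ.Signal (Measure.dirac (PUnit.unit : PUnit.{u + 1})))),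
    (Kernel.const_comp' (Measure.dirac (PUnit.unit : PUnit.{u + 1})) σ.kernel).symm⟩

variable [StandardBorelSpace Ω] [Nonempty Ω]

namespace Experiment

lemma measurable_post (σ : Experiment Ω) (μ : ProbabilityMeasure Ω) : Measurable (σ.post μ) :=
  (Kernel.measurable _).subtype_mk

instance (σ : Experiment Ω) (μ : ProbabilityMeasure Ω) : IsProbabilityMeasure (σ.law μ) :=
  Measure.isProbabilityMeasure_map (σ.measurable_post μ).aemeasurable

lemma law_full (μ : ProbabilityMeasure Ω) :
    (full Ω).law μ = (μ : Measure Ω).map certain := by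
  have h : (Kernel.id : Kernel Ω Ω) ∘ₘ (μ : Measure Ω) = μ := Measure.id_comp
  change ((Kernel.id : Kernel Ω Ω) ∘ₘ (μ : Measure Ω)).map ((full Ω).post μ) = _
  rw [h]
  refine Measure.map_congr ?_
  filter_upwards [posterior_id (μ : Measure Ω)] with ω hω
  refine Subtype.ext ?_
  exact hω.trans (Kernel.id_apply ω)

lemma law_null (μ : ProbabilityMeasure Ω) : (null Ω).law μ = Measure.dirac μ := by
  let κ : Kernel Ω PUnit.{u + 1} := Kernel.const Ω (Measure.dirac PUnit.unit)
  have h : κ ∘ₘ (μ : Measure Ω) = Measure.dirac PUnit.unit := by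
    simp [κ, Measure.const_comp]
  -- Posteriors average to the prior, and here there is only one of them.
  have hp : posterior κ (μ : Measure Ω) PUnit.unit = μ := by
    have := posterior_comp_self (κ := κ) (μ := (μ : Measure Ω))
    rwa [h, Measure.dirac_bind (Kernel.measurable _)] at this
  change (κ ∘ₘ (μ : Measure Ω)).map ((null Ω).post μ) = _
  rw [h]
  refine (Measure.map_dirac' ((null Ω).measurable_post μ) PUnit.unit).trans ?_
  exact congrArg _ (Subtype.ext hp)

/-- No signal moves a degenerate belief: the constant kernel satisfies the disintegration identity
that characterizes the posterior almost surely. -/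
lemma law_certain (σ : Experiment Ω) (ω : Ω) :
    σ.law (certain ω) = Measure.dirac (certain ω) := by
  have h : σ.kernel ∘ₘ (Measure.dirac ω) = σ.kernel ω :=
    Measure.dirac_bind (Kernel.measurable _) _
  have hae : Kernel.const σ.Signal (Measure.dirac ω) =ᵐ[σ.kernel ∘ₘ (Measure.dirac ω)]
      posterior σ.kernel (Measure.dirac ω) := by
    refine ae_eq_posterior_of_compProd_eq ?_
    rw [h, Measure.compProd_const]
    have hd : Measure.dirac ω ⊗ₘ σ.kernel = (σ.kernel ω).map (Prod.mk ω) := by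
      ext t ht
      rw [Measure.dirac_compProd_apply ht, Measure.map_apply measurable_prodMk_left ht]
    rw [hd, Measure.map_map measurable_swap measurable_prodMk_left, Measure.prod_dirac]
    rfl
  have : σ.post (certain ω) =ᵐ[σ.kernel ∘ₘ (Measure.dirac ω)] fun _ => certain ω := by
    filter_upwards [hae] with s hs
    exact Subtype.ext hs.symm
  change (σ.kernel ∘ₘ (Measure.dirac ω)).map (σ.post (certain ω)) = _
  rw [Measure.map_congr this, Measure.map_const]
  simp

end Experiment

end Laws

/-! ### Value with acquisition as a function of the type -/

namespace Environment

variable {Ω : Type u} [MeasurableSpace Ω] [StandardBorelSpace Ω] [Nonempty Ω]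
variable (E : Environment Ω)

/-- The expected value of `v` under full information at the belief `μ`. -/
noncomputable def vfull (μ : ProbabilityMeasure Ω) : ℝ := ∫ ω, E.v (certain ω) ∂(μ : Measure Ω)

variable {E} {μ : ProbabilityMeasure Ω}

lemma integrable_v_certain (hμ : μ ∈ E.beliefs) :
    Integrable (fun ω => E.v (certain ω)) (μ : Measure Ω) := by
  have := E.v_integrable μ hμ (Experiment.full Ω)
  rw [Experiment.law_full] at this
  exact this.comp_measurable measurable_certain

lemma integral_v_full (hμ : μ ∈ E.beliefs) :
    ∫ ν, E.v ν ∂((Experiment.full Ω).law μ) = E.vfull μ := by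
  have := E.v_integrable μ hμ (Experiment.full Ω)
  rw [Experiment.law_full] at this ⊢
  exact integral_map measurable_certain.aemeasurable this.1

lemma integral_v_null (μ : ProbabilityMeasure Ω) :
    ∫ ν, E.v ν ∂((Experiment.null Ω).law μ) = E.v μ := by
  rw [Experiment.law_null, integral_dirac]

lemma integral_v_le_vfull (hμ : μ ∈ E.beliefs) (σ : Experiment Ω) :
    ∫ ν, E.v ν ∂(σ.law μ) ≤ E.vfull μ := by
  rw [← integral_v_full hμ]
  exact E.v_blackwell μ hμ _ _ σ.isGarblingOf_full

lemma v_le_integral_v (hμ : μ ∈ E.beliefs) (σ : Experiment Ω) :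
    E.v μ ≤ ∫ ν, E.v ν ∂(σ.law μ) := by
  rw [← E.integral_v_null μ]
  exact E.v_blackwell μ hμ _ _ σ.null_isGarblingOf

lemma v_le_vfull (hμ : μ ∈ E.beliefs) : E.v μ ≤ E.vfull μ :=
  (v_le_integral_v hμ (Experiment.null Ω)).trans (integral_v_le_vfull hμ _)

lemma net_eq (σ : Experiment Ω) (μ : ProbabilityMeasure Ω) (θ : ℝ) :
    E.net σ μ θ = (∫ ν, E.v ν ∂(σ.law μ)) * θ - E.cost σ μ := by
  simp only [net, V, integral_mul_const]

lemma net_null (hμ : μ ∈ E.beliefs) (θ : ℝ) :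
    E.net (Experiment.null Ω) μ θ = E.v μ * θ := by
  rw [net_eq, integral_v_null, E.cost_null μ hμ, sub_zero]

instance : Nonempty E.acq := ⟨⟨_, E.null_mem⟩⟩

lemma net_le_vfull_mul (hμ : μ ∈ E.beliefs) {θ : ℝ} (hθ : 0 ≤ θ) {σ : Experiment Ω}
    (hσ : σ ∈ E.acq) : E.net σ μ θ ≤ E.vfull μ * θ := by
  rw [net_eq]
  have := mul_le_mul_of_nonneg_right (integral_v_le_vfull hμ σ) hθ
  linarith [E.cost_nonneg σ hσ μ hμ]

lemma bddAbove_net (hμ : μ ∈ E.beliefs) {θ : ℝ} (hθ : 0 ≤ θ) :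
    BddAbove (range fun σ : E.acq => E.net σ.1 μ θ) :=
  ⟨E.vfull μ * θ, by rintro _ ⟨σ, rfl⟩; exact net_le_vfull_mul hμ hθ σ.2⟩

lemma net_le_Vacq (hμ : μ ∈ E.beliefs) {θ : ℝ} (hθ : 0 ≤ θ) {σ : Experiment Ω}
    (hσ : σ ∈ E.acq) : E.net σ μ θ ≤ E.Vacq μ θ :=
  le_ciSup (bddAbove_net hμ hθ) (⟨σ, hσ⟩ : E.acq)

lemma v_mul_le_Vacq (hμ : μ ∈ E.beliefs) {θ : ℝ} (hθ : 0 ≤ θ) : E.v μ * θ ≤ E.Vacq μ θ :=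
  (net_null hμ θ).symm.trans_le (net_le_Vacq hμ hθ E.null_mem)

/-- For each experiment the net payoff is affine in the type, with slope at most `vfull μ` (and at
least `v μ`, for the companion bound). A supremum of such functions keeps the slope bounds. -/
lemma Vacq_sub_le (hμ : μ ∈ E.beliefs) {x y : ℝ} (hx : 0 ≤ x) (hxy : x ≤ y) :
    E.Vacq μ y - E.Vacq μ x ≤ E.vfull μ * (y - x) := by
  rw [sub_le_iff_le_add]
  refine ciSup_le fun σ => ?_
  have h1 := net_le_Vacq hμ hx σ.2
  have h2 := mul_le_mul_of_nonneg_right (integral_v_le_vfull hμ σ.1) (sub_nonneg.2 hxy)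
  rw [net_eq] at h1 ⊢
  linarith

lemma le_Vacq_sub (hμ : μ ∈ E.beliefs) {x y : ℝ} (hx : 0 ≤ x) (hxy : x ≤ y) :
    E.v μ * (y - x) ≤ E.Vacq μ y - E.Vacq μ x := by
  rw [le_sub_iff_add_le, add_comm, ← le_sub_iff_add_le]
  refine ciSup_le fun σ => ?_
  have h1 := net_le_Vacq hμ (hx.trans hxy) σ.2
  have h2 := mul_le_mul_of_nonneg_right (v_le_integral_v hμ σ.1) (sub_nonneg.2 hxy)
  rw [net_eq] at h1 ⊢
  linarith

/-- `Vacq μ θ / θ` is nondecreasing in `θ`, as costs are nonnegative. -/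
lemma mul_Vacq_le_mul_Vacq (hμ : μ ∈ E.beliefs) {x y : ℝ} (hx : 0 < x) (hxy : x ≤ y) :
    y * E.Vacq μ x ≤ x * E.Vacq μ y := by
  rw [← le_div_iff₀' (hx.trans_le hxy)]
  refine ciSup_le fun σ => ?_
  rw [le_div_iff₀' (hx.trans_le hxy)]
  have h1 := mul_le_mul_of_nonneg_left (net_le_Vacq hμ (hx.le.trans hxy) σ.2) hx.le
  have h2 := mul_le_mul_of_nonneg_right hxy (E.cost_nonneg σ σ.2 μ hμ)
  rw [net_eq] at h1 ⊢
  linarith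

lemma Vacq_certain {ω : Ω} (hμ : certain ω ∈ E.beliefs) {θ : ℝ} (hθ : 0 ≤ θ) :
    E.Vacq (certain ω) θ = E.v (certain ω) * θ := by
  refine le_antisymm (ciSup_le fun σ => ?_) (v_mul_le_Vacq hμ hθ)
  rw [net_eq, Experiment.law_certain, integral_dirac]
  linarith [E.cost_nonneg σ σ.2 _ hμ]

lemma Vacq_full_ae {θ : ℝ} (hθ : 0 ≤ θ) :
    (fun μ => E.Vacq μ θ) =ᵐ[(Experiment.full Ω).law E.prior] fun μ => E.v μ * θ := by
  have hb := E.post_mem _ E.prior_mem (Experiment.full Ω)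
  have hc : ∀ᵐ μ ∂((Experiment.full Ω).law E.prior), μ ∈ range (certain (Ω := Ω)) := by
    rw [Experiment.law_full, ← image_univ]
    refine (ae_map_iff measurable_certain.aemeasurable ?_).2 (by simp)
    -- Lusin–Souslin: the injective measurable image of a standard Borel space in a countably
    -- separated space is measurable.
    exact MeasurableSet.univ.image_of_measurable_injOn measurable_certain
      certain_injective.injOn
  filter_upwards [hb, hc] with μ hμ ⟨ω, hω⟩
  subst hω
  exact Vacq_certain hμ hθ

/-- `vfull` is linear in the belief, so its mean over posteriors is its value at the prior belief.
-/
lemma integrable_vfull_post (σ : Experiment Ω) (hμ : μ ∈ E.beliefs) :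
    Integrable (fun s => E.vfull (σ.post μ s)) (σ.kernel ∘ₘ (μ : Measure Ω)) ∧
    ∫ s, E.vfull (σ.post μ s) ∂(σ.kernel ∘ₘ (μ : Measure Ω)) = E.vfull μ := by
  have h := integrable_v_certain hμ
  rw [← posterior_comp_self (κ := σ.kernel) (μ := (μ : Measure Ω))] at h
  obtain ⟨h1, h2⟩ := integral_measure_comp h
  rw [posterior_comp_self] at h2
  exact ⟨h1, h2⟩

lemma integral_Vacq_sub_le (σ : Experiment Ω) (hμ : μ ∈ E.beliefs) {x y : ℝ} (hx : 0 ≤ x)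
    (hxy : x ≤ y) (hix : Integrable (fun ν => E.Vacq ν x) (σ.law μ))
    (hiy : Integrable (fun ν => E.Vacq ν y) (σ.law μ)) :
    ∫ ν, E.Vacq ν y ∂(σ.law μ) - ∫ ν, E.Vacq ν x ∂(σ.law μ) ≤ E.vfull μ * (y - x) := by
  have hp := σ.measurable_post μ
  obtain ⟨hi, he⟩ := integrable_vfull_post σ hμ
  have hb : ∀ᵐ s ∂(σ.kernel ∘ₘ (μ : Measure Ω)), σ.post μ s ∈ E.beliefs :=
    ae_of_ae_map hp.aemeasurable (E.post_mem μ hμ σ)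
  rw [← integral_sub hiy hix, ← he, ← integral_mul_const]
  -- The comparison is made on the signal space, where integrability of `vfull` along posteriors is
  -- available.
  refine (integral_map hp.aemeasurable (hiy.sub hix).1).trans_le ?_
  refine integral_mono_ae ((hiy.sub hix).comp_measurable hp) (hi.mul_const _) ?_
  filter_upwards [hb] with s hs using Vacq_sub_le hs hx hxy

lemma le_integral_Vacq_sub (σ : Experiment Ω) (hμ : μ ∈ E.beliefs) {x y : ℝ} (hx : 0 ≤ x)
    (hxy : x ≤ y) (hix : Integrable (fun ν => E.Vacq ν x) (σ.law μ))
    (hiy : Integrable (fun ν => E.Vacq ν y) (σ.law μ)) :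
    E.v μ * (y - x) ≤ ∫ ν, E.Vacq ν y ∂(σ.law μ) - ∫ ν, E.Vacq ν x ∂(σ.law μ) := by
  refine (mul_le_mul_of_nonneg_right (v_le_integral_v hμ σ) (sub_nonneg.2 hxy)).trans ?_
  rw [← integral_sub hiy hix, ← integral_mul_const]
  refine integral_mono_ae ((E.v_integrable μ hμ σ).mul_const _) (hiy.sub hix) ?_
  filter_upwards [E.post_mem μ hμ σ] with s hs using le_Vacq_sub hs hx hxy

lemma mul_integral_Vacq_le (σ : Experiment Ω) (hμ : μ ∈ E.beliefs) {x y : ℝ} (hx : 0 < x)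
    (hxy : x ≤ y) (hix : Integrable (fun ν => E.Vacq ν x) (σ.law μ))
    (hiy : Integrable (fun ν => E.Vacq ν y) (σ.law μ)) :
    y * ∫ ν, E.Vacq ν x ∂(σ.law μ) ≤ x * ∫ ν, E.Vacq ν y ∂(σ.law μ) := by
  rw [← integral_const_mul, ← integral_const_mul]
  refine integral_mono_ae (hix.const_mul _) (hiy.const_mul _) ?_
  filter_upwards [E.post_mem μ hμ σ] with s hs using mul_Vacq_le_mul_Vacq hs hx hxy

/-! ### Slope and ratio bounds for allocations; full and null allocations -/

section Value

variable {π : RandomExperiment Ω} {x y : ℝ}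

lemma value_sub_le (hx : 0 ≤ x) (hxy : x ≤ y)
    (hix : π.HasExpect E.prior fun μ => E.Vacq μ x)
    (hiy : π.HasExpect E.prior fun μ => E.Vacq μ y) :
    E.value π y - E.value π x ≤ E.vfull E.prior * (y - x) := by
  have hc : E.vfull E.prior * (y - x) = ∫ _, E.vfull E.prior * (y - x) ∂π.prob := by simp
  rw [value, value, RandomExperiment.expect, RandomExperiment.expect,
    ← integral_sub hiy.2 hix.2, hc]
  refine integral_mono_ae (hiy.2.sub hix.2) (integrable_const _) ?_
  filter_upwards [hix.1, hiy.1] with i h1 h2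
    using integral_Vacq_sub_le _ E.prior_mem hx hxy h1 h2

lemma le_value_sub (hx : 0 ≤ x) (hxy : x ≤ y)
    (hix : π.HasExpect E.prior fun μ => E.Vacq μ x)
    (hiy : π.HasExpect E.prior fun μ => E.Vacq μ y) :
    E.v E.prior * (y - x) ≤ E.value π y - E.value π x := by
  have hc : E.v E.prior * (y - x) = ∫ _, E.v E.prior * (y - x) ∂π.prob := by simp
  rw [value, value, RandomExperiment.expect, RandomExperiment.expect,
    ← integral_sub hiy.2 hix.2, hc]
  refine integral_mono_ae (integrable_const _) (hiy.2.sub hix.2) ?_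
  filter_upwards [hix.1, hiy.1] with i h1 h2
    using le_integral_Vacq_sub _ E.prior_mem hx hxy h1 h2

lemma mul_value_le_mul_value (hx : 0 < x) (hxy : x ≤ y)
    (hix : π.HasExpect E.prior fun μ => E.Vacq μ x)
    (hiy : π.HasExpect E.prior fun μ => E.Vacq μ y) :
    y * E.value π x ≤ x * E.value π y := by
  rw [value, value, RandomExperiment.expect, RandomExperiment.expect,
    ← integral_const_mul, ← integral_const_mul]
  refine integral_mono_ae (hix.2.const_mul _) (hiy.2.const_mul _) ?_
  filter_upwards [hix.1, hiy.1] with i h1 h2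
    using mul_integral_Vacq_le _ E.prior_mem hx hxy h1 h2

end Value

instance (σ : Experiment Ω) : IsProbabilityMeasure (RandomExperiment.det σ).prob :=
  (RandomExperiment.det σ).isProb

lemma hasExpect_det {σ : Experiment Ω} {g : ProbabilityMeasure Ω → ℝ}
    (h : Integrable g (σ.law μ)) : (RandomExperiment.det σ).HasExpect μ g :=
  ⟨Filter.Eventually.of_forall fun _ => h,
    integrable_const (μ := (RandomExperiment.det σ).prob) (∫ ν, g ν ∂(σ.law μ))⟩

lemma value_det (σ : Experiment Ω) (θ : ℝ) :
    E.value (RandomExperiment.det σ) θ = ∫ μ, E.Vacq μ θ ∂(σ.law E.prior) :=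
  (integral_const (μ := (RandomExperiment.det σ).prob) (∫ μ, E.Vacq μ θ ∂(σ.law E.prior))).trans
    (by simp)

lemma value_det_null (θ : ℝ) :
    E.value (RandomExperiment.det (Experiment.null Ω)) θ = E.Vacq E.prior θ := by
  rw [value_det, Experiment.law_null, integral_dirac]

lemma value_det_full {θ : ℝ} (hθ : 0 ≤ θ) :
    E.value (RandomExperiment.det (Experiment.full Ω)) θ = E.vfull E.prior * θ := by
  rw [value_det, integral_congr_ae (Vacq_full_ae hθ), integral_mul_const,
    integral_v_full E.prior_mem]

lemma hasExpect_full {θ : ℝ} (hθ : 0 ≤ θ) :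
    (RandomExperiment.det (Experiment.full Ω)).HasExpect E.prior fun μ => E.Vacq μ θ :=
  hasExpect_det (((E.v_integrable _ E.prior_mem _).mul_const θ).congr (Vacq_full_ae hθ).symm)

lemma hasExpect_null (θ : ℝ) :
    (RandomExperiment.det (Experiment.null Ω)).HasExpect E.prior fun μ => E.Vacq μ θ :=
  hasExpect_det (by rw [Experiment.law_null]; exact integrable_dirac (by simp))

end Environment

end InfoSale

namespace InfoSale

/-! ### One-dimensional revenue bound via virtual values -/

section Revenue

variable {a b : ℝ} {f : ℝ → ℝ} {F : Measure ℝ}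

lemma integral_eq_integral_mul_density (hf : Measurable f) (hpos : ∀ θ ∈ Ioo a b, 0 < f θ)
    (hF : F = (volume.restrict (Icc a b)).withDensity fun θ => ENNReal.ofReal (f θ))
    (g : ℝ → ℝ) : ∫ θ, g θ ∂F = ∫ θ in Ioo a b, g θ * f θ := by
  rw [hF, integral_withDensity_eq_integral_toReal_smul (by fun_prop) (by simp),
    integral_Icc_eq_integral_Ioo]
  refine setIntegral_congr_fun measurableSet_Ioo fun θ hθ => ?_
  simp [ENNReal.toReal_ofReal (hpos θ hθ).le, mul_comm]

lemma ae_of_forall_Ioo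
    (hF : F = (volume.restrict (Icc a b)).withDensity fun θ => ENNReal.ofReal (f θ))
    {p : ℝ → Prop} (h : ∀ᵐ θ, θ ∈ Ioo a b → p θ) : ∀ᵐ θ ∂F, p θ := by
  rw [hF]
  refine (withDensity_absolutelyContinuous _ _).ae_le ?_
  rw [← restrict_Ioo_eq_restrict_Icc]
  exact (ae_restrict_iff' measurableSet_Ioo).2 h

lemma integrableOn_density [IsProbabilityMeasure F] (hf : Measurable f)
    (hF : F = (volume.restrict (Icc a b)).withDensity fun θ => ENNReal.ofReal (f θ))
    (hpos : ∀ θ ∈ Ioo a b, 0 < f θ) : IntegrableOn f (Ioo a b) := by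
  have h1 : ∫⁻ θ in Icc a b, ENNReal.ofReal (f θ) = 1 := by
    rw [← setLIntegral_univ, ← withDensity_apply _ MeasurableSet.univ, ← hF, measure_univ]
  have h2 := integrable_toReal_of_lintegral_ne_top (μ := volume.restrict (Icc a b))
    (f := fun θ => ENNReal.ofReal (f θ)) (by fun_prop) (by simp [h1])
  refine IntegrableOn.congr_fun (IntegrableOn.mono_set h2 Ioo_subset_Icc_self) (fun θ hθ => ?_)
    measurableSet_Ioo
  exact ENNReal.toReal_ofReal (hpos θ hθ).le

lemma integral_Ioo_indicator {w : ℝ → ℝ} {θ : ℝ} (hθ : θ ∈ Ioo a b) :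
    ∫ t in Ioo a b, (if t < θ then w t else 0) = ∫ t in a..θ, w t := by
  rw [intervalIntegral.integral_of_le hθ.1.le, integral_Ioc_eq_integral_Ioo]
  have : (fun t => if t < θ then w t else 0) = (Iio θ).indicator w := by
    ext t; simp [indicator_apply]
  rw [this, setIntegral_indicator measurableSet_Iio, Ioo_inter_Iio, min_eq_right hθ.2.le]

/-- Expected virtual surplus: integration by parts against the distribution of types. -/
lemma virtual_surplus [IsProbabilityMeasure F] (hf : Measurable f)
    (hpos : ∀ θ ∈ Ioo a b, 0 < f θ)
    (hF : F = (volume.restrict (Icc a b)).withDensity fun θ => ENNReal.ofReal (f θ))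
    {w : ℝ → ℝ} (hw : Measurable w) {K : ℝ} (hK : ∀ t, ‖w t‖ ≤ K) :
    Integrable (fun θ => θ * w θ - ∫ t in a..θ, w t) F ∧
    IntegrableOn (fun t => w t * virtualValue F f t * f t) (Ioo a b) ∧
    ∫ θ, (θ * w θ - ∫ t in a..θ, w t) ∂F =
      ∫ t in Ioo a b, w t * virtualValue F f t * f t := by
  have hIoo : ∀ᵐ θ ∂F, θ ∈ Ioo a b := ae_of_forall_Ioo hF (ae_of_all _ fun _ h => h)
  have hint1 : Integrable (fun θ => θ * w θ) F := by
    refine Integrable.of_bound (C := max |a| |b| * K) (by fun_prop) ?_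
    filter_upwards [hIoo] with θ hθ
    rw [norm_mul]
    refine mul_le_mul ?_ (hK θ) (norm_nonneg _) (by positivity)
    exact abs_le_max_abs_abs hθ.1.le hθ.2.le
  -- With the rent written as an integral over the fixed interval, Fubini replaces it by `w t` times
  -- the tail mass `1 - F t`.
  have hG : Measurable (fun p : ℝ × ℝ => if p.2 < p.1 then w p.2 else 0) :=
    Measurable.ite (measurableSet_lt measurable_snd measurable_fst) (by fun_prop) measurable_const
  have hGi : Integrable (fun p : ℝ × ℝ => if p.2 < p.1 then w p.2 else 0)
      (F.prod (volume.restrict (Ioo a b))) := by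
    refine Integrable.of_bound (C := K) hG.aestronglyMeasurable (ae_of_all _ fun p => ?_)
    split_ifs
    · exact hK _
    · simpa using (norm_nonneg _).trans (hK 0)
  have hrent : (fun θ => ∫ t in Ioo a b, (if t < θ then w t else 0)) =ᵐ[F]
      fun θ => ∫ t in a..θ, w t := by
    filter_upwards [hIoo] with θ hθ using integral_Ioo_indicator hθ
  have hint2 : Integrable (fun θ => ∫ t in a..θ, w t) F := hGi.integral_prod_left.congr hrent
  have htail : ∀ t, ∫ θ, (if t < θ then w t else 0) ∂F = w t * (1 - cdf F t) := fun t => by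
    have : (fun θ => if t < θ then w t else 0) = (Ioi t).indicator fun _ => w t := by
      ext θ; simp [indicator_apply]
    rw [this, integral_indicator_const _ measurableSet_Ioi, ← compl_Iic,
      probReal_compl_eq_one_sub measurableSet_Iic, cdf_eq_real, smul_eq_mul, mul_comm]
  have hswap : ∫ θ, (∫ t in a..θ, w t) ∂F = ∫ t in Ioo a b, w t * (1 - cdf F t) := by
    rw [← integral_congr_ae hrent, integral_integral_swap hGi]
    simp_rw [htail]
  have hi2 : IntegrableOn (fun t => w t * (1 - cdf F t)) (Ioo a b) := by
    have := hGi.integral_prod_right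
    simp only [htail] at this
    exact this
  have hi1 : IntegrableOn (fun t => t * w t * f t) (Ioo a b) := by
    refine Integrable.bdd_mul (c := max |a| |b| * K) (integrableOn_density hf hF hpos)
      (by fun_prop) ?_
    filter_upwards [ae_restrict_mem measurableSet_Ioo] with θ hθ
    rw [norm_mul]
    refine mul_le_mul ?_ (hK θ) (norm_nonneg _) (by positivity)
    exact abs_le_max_abs_abs hθ.1.le hθ.2.le
  have hEq : EqOn (fun t => t * w t * f t - w t * (1 - cdf F t))
      (fun t => w t * virtualValue F f t * f t) (Ioo a b) := fun t ht => by
    have := (hpos t ht).ne'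
    simp only [virtualValue]
    field_simp
  refine ⟨hint1.sub hint2, (hi1.sub hi2).congr_fun hEq measurableSet_Ioo, ?_⟩
  rw [integral_sub hint1 hint2, hswap, integral_eq_integral_mul_density hf hpos hF,
    ← integral_sub hi1 hi2]
  exact setIntegral_congr_fun measurableSet_Ioo hEq

/-- The mean virtual value is `a ≥ 0` (take `w = 1` in `virtual_surplus`), so it cannot be negative
throughout. Hence the infimum defining `monopolyType` is over a nonempty set. -/
lemma exists_nonneg_virtualValue [IsProbabilityMeasure F] (ha : 0 ≤ a) (hab : a < b)
    (hf : Measurable f) (hpos : ∀ θ ∈ Ioo a b, 0 < f θ)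
    (hF : F = (volume.restrict (Icc a b)).withDensity fun θ => ENNReal.ofReal (f θ)) :
    ∃ θ ∈ Ioo a b, 0 ≤ virtualValue F f θ := by
  by_contra! hneg
  obtain ⟨-, hi, he⟩ := virtual_surplus hf hpos hF (w := fun _ => 1) measurable_const
    (K := 1) (by simp)
  have h1 : ∫ θ, (θ * 1 - ∫ t in a..θ, (1 : ℝ)) ∂F = a := by simp
  rw [h1] at he
  have hi' : IntegrableOn (fun t => -(1 * virtualValue F f t * f t)) (Ioo a b) := hi.neg
  have h2 : 0 < ∫ t in Ioo a b, -(1 * virtualValue F f t * f t) := by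
    refine (setIntegral_pos_iff_support_of_nonneg_ae ?_ hi').2 ?_
    · filter_upwards [ae_restrict_mem measurableSet_Ioo] with t ht
      have := mul_neg_of_neg_of_pos (hneg t ht) (hpos t ht)
      simp only [Pi.zero_apply]; linarith
    · have : (Function.support fun t => -(1 * virtualValue F f t * f t)) ∩ Ioo a b = Ioo a b := by
        refine inter_eq_right.2 fun t ht => ?_
        have := mul_neg_of_neg_of_pos (hneg t ht) (hpos t ht)
        rw [Function.mem_support]
        linarith
      rw [this, Real.volume_Ioo]
      simpa using hab
  rw [integral_neg, ← he] at h2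
  linarith

lemma monopolyType_le {θ : ℝ} (hθ : θ ∈ Ioo a b) (h : 0 ≤ virtualValue F f θ) :
    monopolyType a b F f ≤ θ :=
  csInf_le ⟨a, fun x (hx : x ∈ Ioo a b ∧ _) => hx.1.1.le⟩ ⟨hθ, h⟩

lemma monopolyType_mem_Ico [IsProbabilityMeasure F] (ha : 0 ≤ a) (hab : a < b)
    (hf : Measurable f) (hpos : ∀ θ ∈ Ioo a b, 0 < f θ)
    (hF : F = (volume.restrict (Icc a b)).withDensity fun θ => ENNReal.ofReal (f θ)) :
    monopolyType a b F f ∈ Ico a b := by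
  obtain ⟨θ, hθ, h⟩ := exists_nonneg_virtualValue ha hab hf hpos hF
  exact ⟨le_csInf ⟨θ, hθ, h⟩ fun x (hx : x ∈ Ioo a b ∧ _) => hx.1.1.le,
    (monopolyType_le hθ h).trans_lt hθ.2⟩

lemma virtualValue_nonneg_of_lt [IsProbabilityMeasure F] (ha : 0 ≤ a) (hab : a < b)
    (hf : Measurable f) (hpos : ∀ θ ∈ Ioo a b, 0 < f θ)
    (hF : F = (volume.restrict (Icc a b)).withDensity fun θ => ENNReal.ofReal (f θ))
    (hreg : MonotoneOn (virtualValue F f) (Ioo a b)) {θ : ℝ} (hθ : θ ∈ Ioo a b)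
    (h : monopolyType a b F f < θ) : 0 ≤ virtualValue F f θ := by
  obtain ⟨θ₀, h₀⟩ := exists_nonneg_virtualValue ha hab hf hpos hF
  obtain ⟨x, hx, hxθ⟩ := exists_lt_of_csInf_lt ⟨θ₀, h₀⟩ h
  exact hx.2.trans (hreg hx.1 hθ hxθ.le)

lemma virtualValue_neg_of_lt {θ : ℝ} (hθ : θ ∈ Ioo a b) (h : θ < monopolyType a b F f) :
    virtualValue F f θ < 0 := by
  by_contra! hn
  exact h.not_ge (monopolyType_le hθ hn)

lemma integral_indicator_Ici {c Δ θ : ℝ} (hc : a ≤ c) (hθ : a ≤ θ) :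
    θ * (Ici c).indicator (fun _ => Δ) θ - ∫ t in a..θ, (Ici c).indicator (fun _ => Δ) t =
      (Ici c).indicator (fun _ => c * Δ) θ := by
  rw [intervalIntegral.integral_of_le hθ, setIntegral_indicator measurableSet_Ici,
    setIntegral_const]
  by_cases h : c ≤ θ
  · have : volume.real (Ioc a θ ∩ Ici c) = θ - c := by
      -- The interval `Ioc a θ` omits `a`, so the intersection is half-open exactly when `c = a`.
      rcases hc.eq_or_lt with rfl | hc
      · rw [inter_eq_left.2 fun x hx => hx.1.le, Real.volume_real_Ioc_of_le h]
      · have : Ioc a θ ∩ Ici c = Icc c θ := by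
          ext x
          simp only [mem_inter_iff, mem_Ioc, mem_Ici, mem_Icc]
          exact ⟨fun hx => ⟨hx.2, hx.1.2⟩, fun hx => ⟨⟨hc.trans_le hx.1, hx.2⟩, hx.1⟩⟩
        rw [this, Real.volume_real_Icc_of_le h]
    rw [this, indicator_of_mem (mem_Ici.2 h), indicator_of_mem (mem_Ici.2 h), smul_eq_mul]
    ring
  · have : Ioc a θ ∩ Ici c = ∅ := by
      ext x
      simp only [mem_inter_iff, mem_Ioc, mem_Ici, mem_empty_iff_false, iff_false]
      exact fun hx => h (hx.2.trans hx.1.2)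
    simp [this, h]

lemma deriv_bounds {W p : ℝ → ℝ} {Δ x : ℝ} (ha : 0 ≤ a) (hx : x ∈ Ioo a b)
    (hmono : ∀ x ∈ Icc a b, ∀ y ∈ Icc a b, x ≤ y → 0 ≤ W y - W x)
    (hlip : ∀ x ∈ Icc a b, ∀ y ∈ Icc a b, x ≤ y → W y - W x ≤ Δ * (y - x))
    (hp : ∀ x ∈ Icc a b, ∀ y ∈ Icc a b, 0 < x → x < y →
      (p x + W x) * (y - x) ≤ x * (W y - W x))
    (hd : DifferentiableAt ℝ W x) :
    deriv W x ∈ Icc 0 Δ ∧ p x ≤ x * deriv W x - W x := by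
  -- Right slopes only, since the price bound `hp` compares `x` with larger types.
  have ht := (hasDerivAt_iff_tendsto_slope.1 hd.hasDerivAt).mono_left
    (nhdsWithin_mono x (fun y hy => (mem_Ioi.1 hy).ne' : Ioi x ⊆ {x}ᶜ))
  have hev : ∀ᶠ y in nhdsWithin x (Ioi x), y ∈ Ioo x b := Ioo_mem_nhdsGT hx.2
  have hxm : x ∈ Icc a b := Ioo_subset_Icc_self hx
  have hm : ∀ y ∈ Ioo x b, y ∈ Icc a b := fun y hy => ⟨hx.1.le.trans hy.1.le, hy.2.le⟩
  have hx0 : 0 < x := ha.trans_lt hx.1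
  refine ⟨⟨?_, ?_⟩, ?_⟩
  · refine ge_of_tendsto ht (hev.mono fun y hy => ?_)
    rw [slope_def_field]
    exact div_nonneg (hmono x hxm y (hm y hy) hy.1.le) (sub_nonneg.2 hy.1.le)
  · refine le_of_tendsto ht (hev.mono fun y hy => ?_)
    rw [slope_def_field, div_le_iff₀ (sub_pos.2 hy.1)]
    exact hlip x hxm y (hm y hy) hy.1.le
  · rw [le_sub_iff_add_le]
    refine ge_of_tendsto (ht.const_mul x) (hev.mono fun y hy => ?_)
    rw [slope_def_field, ← mul_div_assoc, le_div_iff₀ (sub_pos.2 hy.1)]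
    exact hp x hxm y (hm y hy) hx0 hy.1

/-- No price schedule whose rents `W` have slopes in `[0, Δ]` raises more revenue than selling
slope `Δ` to all types above the monopoly type. -/
lemma integral_price_le [IsProbabilityMeasure F] (ha : 0 ≤ a) (hab : a < b)
    (hf : Measurable f) (hpos : ∀ θ ∈ Ioo a b, 0 < f θ)
    (hF : F = (volume.restrict (Icc a b)).withDensity fun θ => ENNReal.ofReal (f θ))
    (hreg : MonotoneOn (virtualValue F f) (Ioo a b)) {W p : ℝ → ℝ} {Δ : ℝ} (hΔ : 0 ≤ Δ)
    (hW : 0 ≤ W a)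
    (hmono : ∀ x ∈ Icc a b, ∀ y ∈ Icc a b, x ≤ y → 0 ≤ W y - W x)
    (hlip : ∀ x ∈ Icc a b, ∀ y ∈ Icc a b, x ≤ y → W y - W x ≤ Δ * (y - x))
    (hp : ∀ x ∈ Icc a b, ∀ y ∈ Icc a b, 0 < x → x < y →
      (p x + W x) * (y - x) ≤ x * (W y - W x))
    (hpi : Integrable p F) :
    ∫ θ, p θ ∂F ≤ ∫ θ, (Ici (monopolyType a b F f)).indicator
      (fun _ => monopolyType a b F f * Δ) θ ∂F := by
  set c := monopolyType a b F f with hc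
  have hcm : c ∈ Ico a b := monopolyType_mem_Ico ha hab hf hpos hF
  have hL : LipschitzOnWith ⟨Δ, hΔ⟩ W (Icc a b) := by
    refine LipschitzOnWith.of_le_add_mul _ fun x hx y hy => ?_
    change W x ≤ W y + Δ * dist x y
    rcases le_total x y with h | h
    · have := hmono x hx y hy h
      have : 0 ≤ Δ * dist x y := by positivity
      linarith
    · have := hlip y hy x hx h
      rw [Real.dist_eq, abs_of_nonneg (sub_nonneg.2 h)]
      linarith
  have hAC : AbsolutelyContinuousOnInterval W a b :=
    LipschitzOnWith.absolutelyContinuousOnInterval (by rwa [uIcc_of_le hab.le])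
  -- Cut off outside the interval, and with `deriv` equal to `0` where `W` is not differentiable,
  -- `w` lies in `[0, Δ]` everywhere.
  let w : ℝ → ℝ := (Ioo a b).indicator (deriv W)
  have hwm : Measurable w := (measurable_deriv W).indicator measurableSet_Ioo
  have hwb : ∀ t, w t ∈ Icc 0 Δ := fun t => by
    by_cases ht : t ∈ Ioo a b
    · simp only [w, indicator_of_mem ht]
      by_cases hd : DifferentiableAt ℝ W t
      · exact (deriv_bounds ha ht hmono hlip hp hd).1
      · rw [deriv_zero_of_not_differentiableAt hd]; exact ⟨le_rfl, hΔ⟩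
    · simp only [w, indicator_of_notMem ht]; exact ⟨le_rfl, hΔ⟩
  obtain ⟨hi1, hi2, he⟩ := virtual_surplus hf hpos hF hwm (K := Δ) fun t => by
    rw [Real.norm_of_nonneg (hwb t).1]; exact (hwb t).2
  obtain ⟨hj1, hj2, hje⟩ := virtual_surplus hf hpos hF
    (w := (Ici c).indicator fun _ => Δ) (measurable_const.indicator measurableSet_Ici) (K := Δ)
    fun t => (norm_indicator_le_norm_self _ _).trans_eq (Real.norm_of_nonneg hΔ)
  calc ∫ θ, p θ ∂F ≤ ∫ θ, (θ * w θ - ∫ t in a..θ, w t) ∂F := by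
        refine integral_mono_ae hpi hi1 (ae_of_forall_Ioo hF ?_)
        filter_upwards [hAC.ae_differentiableAt] with θ hd hθ
        have hθ' : θ ∈ uIcc a b := by rw [uIcc_of_le hab.le]; exact Ioo_subset_Icc_self hθ
        have h1 := (deriv_bounds ha hθ hmono hlip hp (hd hθ')).2
        have h2 : ∫ t in a..θ, w t = W θ - W a := by
          rw [← (hAC.mono (uIcc_subset_uIcc_left hθ')).integral_deriv_eq_sub]
          refine intervalIntegral.integral_congr_ae (ae_of_all _ fun t ht => ?_)
          rw [uIoc_of_le hθ.1.le] at ht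
          have ht' : t ∈ Ioo a b := ⟨ht.1, ht.2.trans_lt hθ.2⟩
          exact indicator_of_mem ht' (deriv W)
        have h3 : w θ = deriv W θ := indicator_of_mem hθ (deriv W)
        rw [h2, h3]
        -- The leftover term `W a` is nonnegative and is dropped.
        linarith
    _ = ∫ t in Ioo a b, w t * virtualValue F f t * f t := he
    _ ≤ ∫ t in Ioo a b, (Ici c).indicator (fun _ => Δ) t * virtualValue F f t * f t := by
        refine integral_mono_ae hi2 hj2 ?_
        -- The sign of the virtual value at `c` itself is not known; a single point is null.
        filter_upwards [ae_restrict_mem measurableSet_Ioo,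
          ae_restrict_of_ae (Measure.ae_ne volume c)] with t ht htc
        refine mul_le_mul_of_nonneg_right ?_ (hpos t ht).le
        rcases lt_or_gt_of_ne htc with h | h
        · rw [indicator_of_notMem (by simpa using h), zero_mul]
          exact mul_nonpos_of_nonneg_of_nonpos (hwb t).1 (virtualValue_neg_of_lt ht h).le
        · rw [indicator_of_mem (mem_Ici.2 h.le)]
          exact mul_le_mul_of_nonneg_right (hwb t).2
            (virtualValue_nonneg_of_lt ha hab hf hpos hF hreg ht h)
    _ = _ := by
        rw [← hje]
        refine integral_congr_ae (ae_of_forall_Ioo hF (ae_of_all _ fun θ hθ => ?_))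
        exact integral_indicator_Ici hcm.1 hθ.1.le

end Revenue

end InfoSale

namespace InfoSale

universe u

/-! ### Rents of feasible mechanisms and optimality of the posted price -/

namespace Environment

variable {Ω : Type u} [MeasurableSpace Ω] [StandardBorelSpace Ω] [Nonempty Ω]
variable {E : Environment Ω} {a b : ℝ} {f : ℝ → ℝ} {F : Measure ℝ}

/-- The payoff of type `θ` in `M` in excess of the value of her prior without acquisition. -/
noncomputable def rent (E : Environment Ω) (M : Mechanism Ω) (θ : ℝ) : ℝ :=
  E.value (M.alloc θ) θ - M.price θ - E.v E.prior * θ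

lemma rent_nonneg {M : Mechanism Ω} (hM : E.IndividuallyRational a b M) (ha : 0 ≤ a) {θ : ℝ}
    (hθ : θ ∈ Icc a b) : 0 ≤ E.rent M θ := by
  have := v_mul_le_Vacq E.prior_mem (ha.trans hθ.1)
  have := hM θ hθ
  rw [rent]
  linarith

/-- Type `y` can report `x`, and the value of the allocation of `x` grows at rate at least `v D`.
The upper bound `rent_sub_le` uses the opposite misreport. -/
lemma rent_mono {M : Mechanism Ω} (hM : E.Feasible a b F M) (ha : 0 ≤ a) {x y : ℝ}
    (hx : x ∈ Icc a b) (hy : y ∈ Icc a b) (hxy : x ≤ y) : 0 ≤ E.rent M y - E.rent M x := by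
  have h1 := hM.2.1 y hy x hx
  have h2 := le_value_sub (ha.trans hx.1) hxy (hM.1.1 x hx x hx) (hM.1.1 y hy x hx)
  rw [rent, rent]
  linarith

lemma rent_sub_le {M : Mechanism Ω} (hM : E.Feasible a b F M) (ha : 0 ≤ a) {x y : ℝ}
    (hx : x ∈ Icc a b) (hy : y ∈ Icc a b) (hxy : x ≤ y) :
    E.rent M y - E.rent M x ≤ (E.vfull E.prior - E.v E.prior) * (y - x) := by
  have h1 := hM.2.1 x hx y hy
  have h2 := value_sub_le (ha.trans hx.1) hxy (hM.1.1 x hx y hy) (hM.1.1 y hy y hy)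
  rw [rent, rent]
  linarith

/-- `price + rent` is the gross value of the allocation of `x` minus `v D * x`. If `y` reports `x`,
that gross value is scaled up by at least `y / x`. -/
lemma price_add_rent_mul_le {M : Mechanism Ω} (hM : E.Feasible a b F M) {x y : ℝ}
    (hx : x ∈ Icc a b) (hy : y ∈ Icc a b) (hx0 : 0 < x) (hxy : x < y) :
    (M.price x + E.rent M x) * (y - x) ≤ x * (E.rent M y - E.rent M x) := by
  have h1 := mul_le_mul_of_nonneg_left (hM.2.1 y hy x hx) hx0.le
  have h2 := mul_value_le_mul_value hx0 hxy.le (hM.1.1 x hx x hx) (hM.1.1 y hy x hx)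
  rw [rent, rent]
  linarith

lemma postedPrice_alloc_price (p θ : ℝ) :
    (E.Buys p θ ∧ (E.postedPrice p).alloc θ = RandomExperiment.det (Experiment.full Ω) ∧
      (E.postedPrice p).price θ = p) ∨
    (¬ E.Buys p θ ∧ (E.postedPrice p).alloc θ = RandomExperiment.det (Experiment.null Ω) ∧
      (E.postedPrice p).price θ = 0) := by
  by_cases h : E.Buys p θ <;> simp [postedPrice, h]

/-- The menu has two items for every type, and `Buys` selects the better one; the null item yields
the outside option. -/
lemma feasible_postedPrice (ha : 0 ≤ a) {p : ℝ} (hp : Integrable (E.postedPrice p).price F) :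
    E.Feasible a b F (E.postedPrice p) := by
  refine ⟨⟨fun θ hθ θ' _ => ?_, hp⟩, fun θ _ θ' _ => ?_, fun θ _ => ?_⟩
  · rcases E.postedPrice_alloc_price p θ' with ⟨-, h, -⟩ | ⟨-, h, -⟩ <;> rw [h]
    · exact hasExpect_full (ha.trans hθ.1)
    · exact hasExpect_null θ
  · rcases E.postedPrice_alloc_price p θ' with ⟨-, h, h'⟩ | ⟨-, h, h'⟩ <;>
    rcases E.postedPrice_alloc_price p θ with ⟨hb, k, k'⟩ | ⟨hb, k, k'⟩ <;>
    rw [h, h', k, k'] <;> simp only [Buys, value_det_null] at hb ⊢ <;> linarith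
  · rcases E.postedPrice_alloc_price p θ with ⟨hb, k, k'⟩ | ⟨hb, k, k'⟩ <;>
    rw [k, k'] <;> simp only [Buys, value_det_null] at hb ⊢ <;> linarith

/-- If the null experiment is optimal for a type, then it is optimal for all lower types. -/
lemma net_le_net_null_of_lt {c θ : ℝ} (hθ : θ < c)
    (hnull : ∀ σ ∈ E.acq, E.net σ E.prior c ≤ E.net (Experiment.null Ω) E.prior c)
    {σ : Experiment Ω} (hσ : σ ∈ E.acq) :
    E.net σ E.prior θ ≤ E.net (Experiment.null Ω) E.prior θ ∧
      (0 < E.cost σ E.prior → E.net σ E.prior θ < E.net (Experiment.null Ω) E.prior θ) := by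
  have h1 := hnull σ hσ
  have h2 := v_le_integral_v E.prior_mem σ
  have h3 := E.cost_nonneg σ hσ _ E.prior_mem
  rw [net_null E.prior_mem, net_eq] at h1 ⊢
  have h4 := mul_le_mul_of_nonneg_right h2 (sub_pos.2 hθ).le
  refine ⟨by linarith, fun hpos => ?_⟩
  -- If `σ` adds nothing to the expected `v`, its positive cost decides; otherwise its gain is
  -- strictly smaller at `θ` than at `c`, where it did not exceed the cost.
  rcases h2.eq_or_lt with h | h
  · rw [← h]; linarith
  · have := mul_lt_mul_of_pos_right h (sub_pos.2 hθ)
    linarith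

lemma Vacq_prior_eq_of_le {c θ : ℝ} (h0 : 0 ≤ θ) (hθ : θ ≤ c)
    (hnull : ∀ σ ∈ E.acq, E.net σ E.prior c ≤ E.net (Experiment.null Ω) E.prior c) :
    E.Vacq E.prior θ = E.v E.prior * θ := by
  refine le_antisymm (ciSup_le fun σ => ?_) (v_mul_le_Vacq E.prior_mem h0)
  rw [← net_null E.prior_mem]
  rcases hθ.eq_or_lt with rfl | h
  · exact hnull σ σ.2
  · exact (net_le_net_null_of_lt h hnull σ.2).1

lemma postedPrice_price_eq {c θ : ℝ} (hc : 0 ≤ c) (h0 : 0 ≤ θ)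
    (hnull : ∀ σ ∈ E.acq, E.net σ E.prior c ≤ E.net (Experiment.null Ω) E.prior c) :
    (E.postedPrice (c * (E.vfull E.prior - E.v E.prior))).price θ =
      (Ici c).indicator (fun _ => c * (E.vfull E.prior - E.v E.prior)) θ := by
  have hΔ := v_le_vfull E.prior_mem
  rcases le_or_gt c θ with h | h
  · rw [indicator_of_mem (mem_Ici.2 h)]
    refine if_pos ?_
    -- Above `c` the outside option may include acquisition, but it grows no faster than the value
    -- of full information, so willingness to pay does not fall below its level at `c`.
    have h1 := Vacq_sub_le E.prior_mem hc h
    rw [Vacq_prior_eq_of_le hc le_rfl hnull] at h1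
    rw [Buys, value_det_full h0]
    linarith
  · rw [indicator_of_notMem (by simpa using h)]
    simp only [postedPrice, ite_eq_right_iff]
    intro hb
    rw [Buys, value_det_full h0, Vacq_prior_eq_of_le h0 h.le hnull] at hb
    rcases hΔ.eq_or_lt with hΔ | hΔ
    -- If full information is worthless, lower types may also buy, but the price is `0`.
    · rw [hΔ, sub_self, mul_zero]
    · have := mul_lt_mul_of_pos_left h (sub_pos.2 hΔ)
      linarith

lemma isOptimal_postedPrice [IsProbabilityMeasure F] (ha : 0 ≤ a) (hab : a < b)
    (hf : Measurable f) (hpos : ∀ θ ∈ Ioo a b, 0 < f θ)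
    (hF : F = (volume.restrict (Icc a b)).withDensity fun θ => ENNReal.ofReal (f θ))
    (hreg : MonotoneOn (virtualValue F f) (Ioo a b))
    (hnull : ∀ σ ∈ E.acq, E.net σ E.prior (monopolyType a b F f) ≤
      E.net (Experiment.null Ω) E.prior (monopolyType a b F f)) :
    E.IsOptimal a b F
      (E.postedPrice (monopolyType a b F f * (E.vfull E.prior - E.v E.prior))) := by
  have hc : 0 ≤ monopolyType a b F f := ha.trans (monopolyType_mem_Ico ha hab hf hpos hF).1
  have hprice := ae_of_forall_Ioo hF (ae_of_all _ fun θ (hθ : θ ∈ Ioo a b) =>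
    postedPrice_price_eq hc (ha.trans hθ.1.le) hnull)
  have hint : Integrable ((Ici (monopolyType a b F f)).indicator
      fun _ => monopolyType a b F f * (E.vfull E.prior - E.v E.prior)) F :=
    (integrable_const _).indicator measurableSet_Ici
  refine ⟨feasible_postedPrice ha (hint.congr (Filter.EventuallyEq.symm hprice)),
    fun M hM => ?_⟩
  rw [revenue, revenue, integral_congr_ae hprice]
  exact integral_price_le ha hab hf hpos hF hreg (W := E.rent M)
    (sub_nonneg.2 (v_le_vfull E.prior_mem))
    (rent_nonneg hM.2.2 ha (left_mem_Icc.2 hab.le))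
    (fun x hx y hy => rent_mono hM ha hx hy)
    (fun x hx y hy => rent_sub_le hM ha hx hy)
    (fun x hx y hy => price_add_rent_mul_le hM hx hy) hM.1.2

end Environment

end InfoSale

theorem proposition3 {Ω : Type*} [MeasurableSpace Ω] [StandardBorelSpace Ω] [Nonempty Ω]
    (E : InfoSale.Environment Ω)
    (a b : ℝ) (ha : 0 ≤ a) (hab : a < b)
    (f : ℝ → ℝ) (hf : Measurable f) (hpos : ∀ θ ∈ Set.Ioo a b, 0 < f θ)
    (F : MeasureTheory.Measure ℝ) [MeasureTheory.IsProbabilityMeasure F]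
    (hF : F = (MeasureTheory.volume.restrict (Set.Icc a b)).withDensity
      (fun θ => ENNReal.ofReal (f θ)))
    (hreg : MonotoneOn (InfoSale.virtualValue F f) (Set.Ioo a b))
    (hnull : ∀ σ ∈ E.acq, E.net σ E.prior (InfoSale.monopolyType a b F f) ≤
      E.net (InfoSale.Experiment.null Ω) E.prior (InfoSale.monopolyType a b F f)) :
    (∃ p : ℝ, 0 ≤ p ∧ E.IsOptimal a b F (E.postedPrice p)) ∧
    (∀ θ ∈ Set.Icc a b, θ < InfoSale.monopolyType a b F f → ∀ σ ∈ E.acq,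
      E.net σ E.prior θ ≤ E.net (InfoSale.Experiment.null Ω) E.prior θ ∧
      (0 < E.cost σ E.prior →
        E.net σ E.prior θ < E.net (InfoSale.Experiment.null Ω) E.prior θ)) := by
  have hΔ := sub_nonneg.2 (InfoSale.Environment.v_le_vfull E.prior_mem)
  have hc := ha.trans (InfoSale.monopolyType_mem_Ico ha hab hf hpos hF).1
  exact ⟨⟨_, mul_nonneg hc hΔ,
    InfoSale.Environment.isOptimal_postedPrice ha hab hf hpos hF hreg hnull⟩,
    fun θ _ hθ σ hσ => InfoSale.Environment.net_le_net_null_of_lt hθ hnull hσ⟩
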